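/- Let $G$ be a non-trivial (discrete) group. Let $\mathcal A_2(G)$ be the universal unital complex algebra with generators $a_{ij}(g)$ ($1\le i,j\le 2$, $g\in G$) and relations $$a_{ij}(g)a_{ik}(h)=\delta_{jk}\,a_{ij}(gh),\qquad a_{ji}(g)a_{ki}(h)=\delta_{jk}\,a_{ji}(gh),\qquad \sum_{l}a_{il}(1)=1=\sum_{l}a_{li}(1),$$ for $1\le i,j,k\le 2$ and $g,h\in G$, with the Hopf algebra structure whose comultiplication and counit are $\Delta(a_{ij}(g))=\sum_k a_{ik}(g)\otimes a_{kj}(g)$ and $\varepsilon(a_{ij}(g))=\delta_{ij}$. Put $x_{ij}=a_{ij}(1)$. Let $G*G$ be the free product of two copies of $G$, mapped multiplicatively to $\mathcal A_2(G)$ by sending $g$ in the $i$-th copy of $G$ to $\sum_k a_{ik}(g)$ (the image of $x\in G*G$ is still written $x$), and let $\tau$ be the involutive automorphism of $G*G$ that exchanges the two copies of $G$. A corepresentation of $\mathcal A_2(G)$ is a complex vector space $V$ (of any dimension) with a right coaction $V\to V\otimes\mathcal A_2(G)$; it is irreducible if $V\neq 0$ and $V$ has no invariant subspace other than $0$ and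 $V$. Write $\mathbb C$ for the trivial corepresentation. Let $d$ be the one-dimensional corepresentation given by the group-like element $x_{11}-x_{12}$, and for $x\in G*G$ let $v_x$ be the two-dimensional corepresentation given by the matrix $$\begin{pmatrix} x\,x_{11} & x\,x_{12}\\ \tau(x)\,x_{21} & \tau(x)\,x_{22}\end{pmatrix}.$$ 1) The corepresentation $d$ is irreducible and not isomorphic to $\mathbb C$. For every $x\in G*G\setminus\{1\}$ the corepresentation $v_x$ is irreducible, and for $x,y\in G*G\setminus\{1\}$ one has $v_x\cong v_y$ if and only if $x=y$ or $x=\tau(y)$. 2) Every irreducible corepresentation of $\mathcal A_2(G)$ that is not isomorphic to $\mathbb C$ is isomorphic to $d$ or to $v_x$ for some $x\in G*G\setminus\{1\}$. 3) For all $x,y\in G*G\setminus\{1\}$ the following fusion rules hold: $$v_x\otimes v_y\cong v_{xy}\oplus v_{x\tau(y)}\quad\text{if } x\neq y^{-1}\text{ and } x\neq\tau(y)^{-1};$$ $$v_x\otimes v_{x^{-1}}\cong\mathbb C\oplus d\oplus v_{x\tau(x)^{-1}};\qquad d\otimes d\cong\mathbb C;\qquad v_x\otimes d\cong d\otimes v_x\cong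 v_x.$$ -/

import Mathlib

open scoped TensorProduct

noncomputable section

/-! # Corepresentations (right comodules) of a complex bialgebra -/

/-- A corepresentation of a complex bialgebra `A` on the complex vector space `V`: a linear map
`ρ : V → V ⊗ A` with `(ρ ⊗ id) ∘ ρ = (id ⊗ Δ) ∘ ρ` and `(id ⊗ ε) ∘ ρ = id`. No finiteness
condition is imposed on `V`. -/
structure Corepresentation (A : Type*) [Semiring A] [Bialgebra ℂ A]
    (V : Type*) [AddCommGroup V] [Module ℂ V] where
  /-- the coaction -/
  coact : V →ₗ[ℂ] V ⊗[ℂ] A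
  coassoc : (TensorProduct.assoc ℂ V A A).toLinearMap ∘ₗ coact.rTensor A ∘ₗ coact =
    (Coalgebra.comul (R := ℂ) (A := A)).lTensor V ∘ₗ coact
  counit_coact : ∀ v : V, (Coalgebra.counit (R := ℂ) (A := A)).lTensor V (coact v) = v ⊗ₜ[ℂ] (1 : ℂ)

namespace Corepresentation

variable {A : Type*} [Semiring A] [Bialgebra ℂ A]
variable {V : Type*} [AddCommGroup V] [Module ℂ V]
variable {W : Type*} [AddCommGroup W] [Module ℂ W]

/-- Two corepresentations are isomorphic (equivalent) if there is a linear isomorphism of the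
underlying spaces that intertwines the coactions. -/
def Iso (ρ : Corepresentation A V) (σ : Corepresentation A W) : Prop :=
  ∃ e : V ≃ₗ[ℂ] W, σ.coact ∘ₗ e.toLinearMap = e.toLinearMap.rTensor A ∘ₗ ρ.coact

/-- A subspace `U` of `V` is invariant if `ρ(U) ⊆ U ⊗ A`, seen inside `V ⊗ A`. -/
def IsInvariant (ρ : Corepresentation A V) (U : Submodule ℂ V) : Prop :=
  ∀ u ∈ U, ρ.coact u ∈ LinearMap.range (U.subtype.rTensor A)

/-- A corepresentation is irreducible if its space is nonzero and has no invariant subspaces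
other than `0` and the whole space. -/
def IsIrreducible (ρ : Corepresentation A V) : Prop :=
  Nontrivial V ∧ ∀ U : Submodule ℂ V, ρ.IsInvariant U → U = ⊥ ∨ U = ⊤

/-- The corepresentation on `ℂⁿ` given by a matrix `u` over `A` satisfying
`Δ(u i j) = ∑ k, u i k ⊗ u k j` and `ε(u i j) = δ i j`; its coaction is
`e j ↦ ∑ i, e i ⊗ u i j`. -/
def ofMatrix {ι : Type*} [Fintype ι] [DecidableEq ι] (u : Matrix ι ι A)
    (hcomul : ∀ i j, Coalgebra.comul (R := ℂ) (u i j) = ∑ k, u i k ⊗ₜ[ℂ] u k j)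
    (hcounit : ∀ i j, Coalgebra.counit (R := ℂ) (u i j) = if i = j then 1 else 0) :
    Corepresentation A (ι → ℂ) where
  coact := (Pi.basisFun ℂ ι).constr ℂ fun j => ∑ i, Pi.single i (1 : ℂ) ⊗ₜ[ℂ] u i j
  coassoc := by
    refine (Pi.basisFun ℂ ι).ext fun j => ?_
    have h : ∀ j, ((Pi.basisFun ℂ ι).constr ℂ fun j => ∑ i, Pi.single i (1 : ℂ) ⊗ₜ[ℂ] u i j)
        (Pi.single j (1 : ℂ)) = ∑ i, Pi.single i (1 : ℂ) ⊗ₜ[ℂ] u i j := fun j => by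
      rw [← Pi.basisFun_apply, Module.Basis.constr_basis]
    simp only [LinearMap.comp_apply, Pi.basisFun_apply, h, map_sum, LinearMap.rTensor_tmul,
      LinearMap.lTensor_tmul, LinearEquiv.coe_coe, TensorProduct.sum_tmul, hcomul,
      TensorProduct.assoc_tmul, TensorProduct.tmul_sum]
    rw [Finset.sum_comm]
  counit_coact := fun v => by
    have h : (Coalgebra.counit (R := ℂ) (A := A)).lTensor (ι → ℂ) ∘ₗ
        ((Pi.basisFun ℂ ι).constr ℂ fun j => ∑ i, Pi.single i (1 : ℂ) ⊗ₜ[ℂ] u i j) =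
        (TensorProduct.mk ℂ (ι → ℂ) ℂ).flip 1 := by
      refine (Pi.basisFun ℂ ι).ext fun j => ?_
      rw [LinearMap.comp_apply, Module.Basis.constr_basis]
      simp [hcounit, TensorProduct.tmul_ite]
    exact LinearMap.congr_fun h v

/-- The one-dimensional corepresentation on `ℂ` given by a group-like element `g`:
`z ↦ z ⊗ g`. -/
def ofGroupLike (g : A) (hg : IsGroupLikeElem ℂ g) : Corepresentation A ℂ where
  coact := (TensorProduct.mk ℂ ℂ A).flip g
  coassoc := by
    ext
    simp [hg.comul_eq_tmul_self]
  counit_coact := fun z => by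
    simp [hg.counit_eq_one]

variable (A) in
/-- The trivial corepresentation `ℂ`: `z ↦ z ⊗ 1`. -/
def trivial : Corepresentation A ℂ := ofGroupLike 1 .one

theorem coassoc_of_comp {U : Type*} [AddCommGroup U] [Module ℂ U] (ρ : Corepresentation A V)
    (c : U →ₗ[ℂ] U ⊗[ℂ] A) (f : V →ₗ[ℂ] U) (hf : c ∘ₗ f = f.rTensor A ∘ₗ ρ.coact) :
    ((TensorProduct.assoc ℂ U A A).toLinearMap ∘ₗ c.rTensor A ∘ₗ c) ∘ₗ f =
      ((Coalgebra.comul (R := ℂ) (A := A)).lTensor U ∘ₗ c) ∘ₗ f := by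
  have h1 : (TensorProduct.assoc ℂ U A A).toLinearMap ∘ₗ (f.rTensor A).rTensor A =
      f.rTensor (A ⊗[ℂ] A) ∘ₗ (TensorProduct.assoc ℂ V A A).toLinearMap := by
    ext; simp
  have h2 : (Coalgebra.comul (R := ℂ) (A := A)).lTensor U ∘ₗ f.rTensor A =
      f.rTensor (A ⊗[ℂ] A) ∘ₗ (Coalgebra.comul (R := ℂ) (A := A)).lTensor V := by
    ext; simp
  calc ((TensorProduct.assoc ℂ U A A).toLinearMap ∘ₗ c.rTensor A ∘ₗ c) ∘ₗ f
      = (TensorProduct.assoc ℂ U A A).toLinearMap ∘ₗ (c ∘ₗ f).rTensor A ∘ₗ ρ.coact := by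
        rw [LinearMap.rTensor_comp, LinearMap.comp_assoc, LinearMap.comp_assoc, hf]; rfl
    _ = ((TensorProduct.assoc ℂ U A A).toLinearMap ∘ₗ (f.rTensor A).rTensor A) ∘ₗ
          ρ.coact.rTensor A ∘ₗ ρ.coact := by
        rw [hf, LinearMap.rTensor_comp]; rfl
    _ = ((Coalgebra.comul (R := ℂ) (A := A)).lTensor U ∘ₗ c) ∘ₗ f := by
        rw [h1, LinearMap.comp_assoc, ρ.coassoc, ← LinearMap.comp_assoc, ← h2,
          LinearMap.comp_assoc, ← hf, LinearMap.comp_assoc]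

theorem counit_of_comp {U : Type*} [AddCommGroup U] [Module ℂ U] (ρ : Corepresentation A V)
    (c : U →ₗ[ℂ] U ⊗[ℂ] A) (f : V →ₗ[ℂ] U) (hf : c ∘ₗ f = f.rTensor A ∘ₗ ρ.coact) (v : V) :
    (Coalgebra.counit (R := ℂ) (A := A)).lTensor U (c (f v)) = f v ⊗ₜ[ℂ] (1 : ℂ) := by
  have h2 : (Coalgebra.counit (R := ℂ) (A := A)).lTensor U ∘ₗ f.rTensor A =
      f.rTensor ℂ ∘ₗ (Coalgebra.counit (R := ℂ) (A := A)).lTensor V := by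
    ext; simp
  have h3 := LinearMap.congr_fun h2 (ρ.coact v)
  have h4 := LinearMap.congr_fun hf v
  simp only [LinearMap.comp_apply] at h3 h4
  rw [h4, h3, ρ.counit_coact, LinearMap.rTensor_tmul]

/-- The direct sum `ρ ⊕ σ`, on `V × W`. -/
def directSum (ρ : Corepresentation A V) (σ : Corepresentation A W) :
    Corepresentation A (V × W) where
  coact := LinearMap.coprod ((LinearMap.inl ℂ V W).rTensor A ∘ₗ ρ.coact)
    ((LinearMap.inr ℂ V W).rTensor A ∘ₗ σ.coact)
  coassoc := LinearMap.prod_ext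
    (coassoc_of_comp ρ _ _ (LinearMap.coprod_inl ..)) (coassoc_of_comp σ _ _ (LinearMap.coprod_inr ..))
  counit_coact := fun v => by
    have h1 := counit_of_comp ρ _ _ (LinearMap.coprod_inl
      ((LinearMap.inl ℂ V W).rTensor A ∘ₗ ρ.coact) ((LinearMap.inr ℂ V W).rTensor A ∘ₗ σ.coact)) v.1
    have h2 := counit_of_comp σ _ _ (LinearMap.coprod_inr
      ((LinearMap.inl ℂ V W).rTensor A ∘ₗ ρ.coact) ((LinearMap.inr ℂ V W).rTensor A ∘ₗ σ.coact)) v.2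
    have hv : v = LinearMap.inl ℂ V W v.1 + LinearMap.inr ℂ V W v.2 := by simp
    rw [hv, map_add, map_add, h1, h2, TensorProduct.add_tmul]

variable (V W) in
/-- The map `(v ⊗ a) ⊗ (w ⊗ b) ↦ (v ⊗ w) ⊗ a b`, for an algebra `B`. -/
def mulCoeff (B : Type*) [Semiring B] [Algebra ℂ B] :
    (V ⊗[ℂ] B) ⊗[ℂ] (W ⊗[ℂ] B) →ₗ[ℂ] (V ⊗[ℂ] W) ⊗[ℂ] B :=
  (LinearMap.mul' ℂ B).lTensor (V ⊗[ℂ] W) ∘ₗ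
    (TensorProduct.tensorTensorTensorComm ℂ V B W B).toLinearMap

theorem mulCoeff_tmul (B : Type*) [Semiring B] [Algebra ℂ B] (v : V) (w : W) (a b : B) :
    mulCoeff V W B ((v ⊗ₜ[ℂ] a) ⊗ₜ[ℂ] (w ⊗ₜ[ℂ] b)) = (v ⊗ₜ[ℂ] w) ⊗ₜ[ℂ] (a * b) := by
  simp [mulCoeff]

theorem mulCoeff_map {B C : Type*} [Semiring B] [Algebra ℂ B] [Semiring C] [Algebra ℂ C]
    (f : B →ₐ[ℂ] C) (t : V ⊗[ℂ] B) (s : W ⊗[ℂ] B) :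
    f.toLinearMap.lTensor (V ⊗[ℂ] W) (mulCoeff V W B (t ⊗ₜ[ℂ] s)) =
      mulCoeff V W C (f.toLinearMap.lTensor V t ⊗ₜ[ℂ] f.toLinearMap.lTensor W s) := by
  induction t with
  | zero => simp
  | add t t' h h' => simp only [TensorProduct.add_tmul, map_add, h, h']
  | tmul v a =>
    induction s with
    | zero => simp
    | add s s' h h' => simp only [TensorProduct.tmul_add, map_add, h, h']
    | tmul w b => simp [mulCoeff_tmul]

theorem mulCoeff_assoc (t : V ⊗[ℂ] A) (s : W ⊗[ℂ] A) (a b : A) :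
    TensorProduct.assoc ℂ (V ⊗[ℂ] W) A A (mulCoeff V W A (t ⊗ₜ[ℂ] s) ⊗ₜ[ℂ] (a * b)) =
      mulCoeff V W (A ⊗[ℂ] A) (TensorProduct.assoc ℂ V A A (t ⊗ₜ[ℂ] a) ⊗ₜ[ℂ]
        TensorProduct.assoc ℂ W A A (s ⊗ₜ[ℂ] b)) := by
  induction t with
  | zero => simp
  | add t t' h h' => simp only [TensorProduct.add_tmul, map_add, h, h']
  | tmul v a =>
    induction s with
    | zero => simp
    | add s s' h h' => simp only [TensorProduct.tmul_add, TensorProduct.add_tmul, map_add, h, h']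
    | tmul w b => simp [mulCoeff_tmul]

/-- The tensor product `ρ ⊗ σ`, on `V ⊗ W`: if `ρ(v) = ∑ v₀ ⊗ a` and `σ(w) = ∑ w₀ ⊗ b`, then
`v ⊗ w ↦ ∑ (v₀ ⊗ w₀) ⊗ a b`. -/
def tensor (ρ : Corepresentation A V) (σ : Corepresentation A W) :
    Corepresentation A (V ⊗[ℂ] W) where
  coact := mulCoeff V W A ∘ₗ TensorProduct.map ρ.coact σ.coact
  coassoc := by
    refine TensorProduct.ext' fun v w => ?_
    have hρ := LinearMap.congr_fun ρ.coassoc v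
    have hσ := LinearMap.congr_fun σ.coassoc w
    have hΔ := mulCoeff_map (Bialgebra.comulAlgHom ℂ A) (ρ.coact v) (σ.coact w)
    simp only [LinearMap.comp_apply, LinearEquiv.coe_coe, TensorProduct.map_tmul] at hρ hσ ⊢
    refine Eq.trans ?_ hΔ.symm
    refine Eq.trans ?_ (congrArg₂ (fun p q => mulCoeff V W (A ⊗[ℂ] A) (p ⊗ₜ[ℂ] q)) hρ hσ)
    generalize ρ.coact v = t
    generalize σ.coact w = s
    induction t with
    | zero => simp
    | add t t' h h' => simp only [TensorProduct.add_tmul, map_add, h, h']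
    | tmul v a =>
      induction s with
      | zero => simp
      | add s s' h h' => simp only [TensorProduct.tmul_add, map_add, h, h']
      | tmul w b =>
        simp only [mulCoeff_tmul, LinearMap.rTensor_tmul, LinearMap.comp_apply,
          TensorProduct.map_tmul, mulCoeff_assoc]
  counit_coact := fun z => by
    induction z with
    | zero => simp
    | add z z' h h' => simp only [TensorProduct.add_tmul, map_add, h, h']
    | tmul v w =>
      refine (mulCoeff_map (Bialgebra.counitAlgHom ℂ A) (ρ.coact v) (σ.coact w)).trans ?_
      refine (congrArg₂ (fun p q => mulCoeff V W ℂ (p ⊗ₜ[ℂ] q)) (ρ.counit_coact v)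
        (σ.counit_coact w)).trans ?_
      simp [mulCoeff_tmul]

end Corepresentation

/-! # The bialgebra `𝒜ₙ(G)` -/

/-- The defining relations of `𝒜ₙ(G)`; the generator `(i, j, g)` stands for `a i j (g)`. -/
inductive AnRel (n : ℕ) (G : Type*) [Group G] :
    FreeAlgebra ℂ (Fin n × Fin n × G) → FreeAlgebra ℂ (Fin n × Fin n × G) → Prop
  | row (i j k : Fin n) (g h : G) : AnRel n G
      (FreeAlgebra.ι ℂ (i, j, g) * FreeAlgebra.ι ℂ (i, k, h))
      (if j = k then FreeAlgebra.ι ℂ (i, j, g * h) else 0)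
  | col (i j k : Fin n) (g h : G) : AnRel n G
      (FreeAlgebra.ι ℂ (j, i, g) * FreeAlgebra.ι ℂ (k, i, h))
      (if j = k then FreeAlgebra.ι ℂ (j, i, g * h) else 0)
  | row_sum (i : Fin n) : AnRel n G (∑ l, FreeAlgebra.ι ℂ (i, l, (1 : G))) 1
  | col_sum (i : Fin n) : AnRel n G (∑ l, FreeAlgebra.ι ℂ (l, i, (1 : G))) 1

/-- The universal unital complex algebra `𝒜ₙ(G)` on generators `a i j (g)` with the relations
`a i j (g) * a i k (h) = δ j k • a i j (g h)`, `a j i (g) * a k i (h) = δ j k • a j i (g h)`,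
`∑ l, a i l (1) = 1 = ∑ l, a l i (1)`. -/
def An (n : ℕ) (G : Type*) [Group G] : Type _ := RingQuot (AnRel n G)

namespace An

variable {n : ℕ} {G : Type*} [Group G]

instance instRing : Ring (An n G) := inferInstanceAs (Ring (RingQuot (AnRel n G)))

instance instAlgebra : Algebra ℂ (An n G) := inferInstanceAs (Algebra ℂ (RingQuot (AnRel n G)))

/-- The generator `a i j (g)` of `𝒜ₙ(G)`. -/
def a (i j : Fin n) (g : G) : An n G :=
  RingQuot.mkAlgHom ℂ (AnRel n G) (FreeAlgebra.ι ℂ (i, j, g))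

theorem a_row (i j k : Fin n) (g h : G) :
    a i j g * a i k h = if j = k then a i j (g * h) else 0 := by
  have := RingQuot.mkAlgHom_rel ℂ (AnRel.row i j k g h)
  rw [map_mul] at this
  refine this.trans ?_
  split_ifs
  · rfl
  · exact map_zero _

theorem a_col (i j k : Fin n) (g h : G) :
    a j i g * a k i h = if j = k then a j i (g * h) else 0 := by
  have := RingQuot.mkAlgHom_rel ℂ (AnRel.col i j k g h)
  rw [map_mul] at this
  refine this.trans ?_
  split_ifs
  · rfl
  · exact map_zero _

theorem a_row_sum (i : Fin n) : ∑ l, a i l (1 : G) = 1 := by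
  have := RingQuot.mkAlgHom_rel ℂ (AnRel.row_sum (G := G) i)
  rw [map_sum, map_one] at this
  exact this

theorem a_col_sum (i : Fin n) : ∑ l, a l i (1 : G) = 1 := by
  have := RingQuot.mkAlgHom_rel ℂ (AnRel.col_sum (G := G) i)
  rw [map_sum, map_one] at this
  exact this

/-- The universal property of `𝒜ₙ(G)`. -/
def lift {B : Type*} [Semiring B] [Algebra ℂ B] (f : Fin n → Fin n → G → B)
    (hrow : ∀ i j k g h, f i j g * f i k h = if j = k then f i j (g * h) else 0)
    (hcol : ∀ i j k g h, f j i g * f k i h = if j = k then f j i (g * h) else 0)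
    (hrow_sum : ∀ i, ∑ l, f i l 1 = 1) (hcol_sum : ∀ i, ∑ l, f l i 1 = 1) : An n G →ₐ[ℂ] B :=
  RingQuot.liftAlgHom ℂ ⟨FreeAlgebra.lift ℂ fun p => f p.1 p.2.1 p.2.2, by
    intro x y hxy
    induction hxy with
    | row i j k g h => simpa [apply_ite (FreeAlgebra.lift ℂ _)] using hrow i j k g h
    | col i j k g h => simpa [apply_ite (FreeAlgebra.lift ℂ _)] using hcol i j k g h
    | row_sum i => simpa using hrow_sum i
    | col_sum i => simpa using hcol_sum i⟩

theorem lift_a {B : Type*} [Semiring B] [Algebra ℂ B] (f : Fin n → Fin n → G → B)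
    (hrow hcol hrow_sum hcol_sum) (i j : Fin n) (g : G) :
    lift f hrow hcol hrow_sum hcol_sum (a i j g) = f i j g := by
  refine (RingQuot.liftAlgHom_mkAlgHom_apply ℂ _ _ _).trans ?_
  simp

theorem algHom_ext {B : Type*} [Semiring B] [Algebra ℂ B] {φ ψ : An n G →ₐ[ℂ] B}
    (h : ∀ i j g, φ (a i j g) = ψ (a i j g)) : φ = ψ := by
  refine RingQuot.ringQuot_ext' ℂ φ ψ ?_
  refine FreeAlgebra.hom_ext (funext fun p => h p.1 p.2.1 p.2.2)

/-- The comultiplication, `Δ(a i j (g)) = ∑ k, a i k (g) ⊗ a k j (g)`. -/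
def comulHom (n : ℕ) (G : Type*) [Group G] : An n G →ₐ[ℂ] An n G ⊗[ℂ] An n G :=
  lift (fun i j g => ∑ k, a i k g ⊗ₜ[ℂ] a k j g)
    (fun i j k g h => by
      simp only [Finset.sum_mul_sum, Algebra.TensorProduct.tmul_mul_tmul, a_row]
      simp only [TensorProduct.ite_tmul, Finset.sum_ite_eq,
        Finset.mem_univ, if_true, a_row]
      split_ifs <;> simp)
    (fun i j k g h => by
      simp only [Finset.sum_mul_sum, Algebra.TensorProduct.tmul_mul_tmul, a_col]
      simp only [TensorProduct.tmul_ite, Finset.sum_ite_eq,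
        Finset.mem_univ, if_true, a_col]
      split_ifs <;> simp)
    (fun i => by
      rw [Finset.sum_comm]
      simp only [← TensorProduct.tmul_sum, a_row_sum, ← TensorProduct.sum_tmul,
        Algebra.TensorProduct.one_def])
    (fun i => by
      rw [Finset.sum_comm]
      simp only [← TensorProduct.tmul_sum, a_col_sum, ← TensorProduct.sum_tmul,
        Algebra.TensorProduct.one_def])

/-- The counit, `ε(a i j (g)) = δ i j`. -/
def counitHom (n : ℕ) (G : Type*) [Group G] : An n G →ₐ[ℂ] ℂ :=
  lift (fun i j _ => if i = j then 1 else 0)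
    (fun i j k g h => by split_ifs <;> simp_all)
    (fun i j k g h => by split_ifs <;> simp_all)
    (fun i => by simp) (fun i => by simp)

theorem comulHom_a (i j : Fin n) (g : G) :
    comulHom n G (a i j g) = ∑ k, a i k g ⊗ₜ[ℂ] a k j g := lift_a ..

theorem counitHom_a (i j : Fin n) (g : G) :
    counitHom n G (a i j g) = if i = j then 1 else 0 := lift_a ..

instance instBialgebra : Bialgebra ℂ (An n G) :=
  Bialgebra.ofAlgHom (comulHom n G) (counitHom n G)
    (algHom_ext fun i j g => by
      simp only [AlgHom.comp_apply, comulHom_a, map_sum, Algebra.TensorProduct.map_tmul,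
        AlgHom.id_apply, TensorProduct.sum_tmul, TensorProduct.tmul_sum]
      rw [Finset.sum_comm]
      rfl)
    (algHom_ext fun i j g => by
      simp [comulHom_a, counitHom_a, TensorProduct.ite_tmul])
    (algHom_ext fun i j g => by
      simp [comulHom_a, counitHom_a, TensorProduct.tmul_ite])

theorem comul_a (i j : Fin n) (g : G) :
    Coalgebra.comul (R := ℂ) (a i j g) = ∑ k, a i k g ⊗ₜ[ℂ] a k j g := comulHom_a i j g

theorem counit_a (i j : Fin n) (g : G) :
    Coalgebra.counit (R := ℂ) (a i j g) = if i = j then 1 else 0 := counitHom_a i j g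

/-- The elements `x i j = a i j (1)`. -/
def x (G : Type*) [Group G] (i j : Fin n) : An n G := a i j 1

/-- The group morphism `νᵢ` from `G` to (the multiplicative monoid of) `𝒜ₙ(G)`,
`νᵢ(g) = ∑ k, a i k (g)`. -/
def nu (i : Fin n) : G →* An n G where
  toFun g := ∑ k, a i k g
  map_one' := a_row_sum i
  map_mul' g h := by simp [Finset.sum_mul_sum, a_row]

end An

/-! # The corepresentations of `𝒜₂(G)` -/

/-- The case `n = 2`. Only the bialgebra structure of the Hopf algebra `𝒜₂(G)` enters the notion of
a corepresentation, its irreducibility, isomorphisms, direct sums and tensor products. -/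
abbrev A2 (G : Type*) [Group G] : Type _ := An 2 G

namespace A2

variable {G : Type*} [Group G]

/-- The multiplicative map `G * G → 𝒜₂(G)` from the free product of groups that extends `ν₁` on
the first and `ν₂` on the second copy of `G` (the indices `1, 2` are `0, 1 : Fin 2` here). -/
def emb : Monoid.Coprod G G →* A2 G := Monoid.Coprod.lift (An.nu 0) (An.nu 1)

/-- The automorphism `τ` of `G * G` that exchanges the two copies of `G`. -/
def tau : Monoid.Coprod G G →* Monoid.Coprod G G := Monoid.Coprod.swap G G

/-- The matrix `A(x)` with entries `A₁₁(x) = x x₁₁`, `A₁₂(x) = x x₁₂`, `A₂₁(x) = τ(x) x₂₁`,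
`A₂₂(x) = τ(x) x₂₂`, for `x` in `G * G`. -/
def vMatrix (x : Monoid.Coprod G G) : Matrix (Fin 2) (Fin 2) (A2 G) :=
  !![emb x * An.x G 0 0, emb x * An.x G 0 1;
     emb (tau x) * An.x G 1 0, emb (tau x) * An.x G 1 1]

theorem x_eq (G : Type*) [Group G] :
    An.x G 1 1 = (An.x G 0 0 : A2 G) ∧ An.x G 1 0 = (An.x G 0 1 : A2 G) := by
  have h1 := An.a_row_sum (n := 2) (G := G) 0
  have h2 := An.a_row_sum (n := 2) (G := G) 1
  have h3 := An.a_col_sum (n := 2) (G := G) 0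
  rw [Fin.sum_univ_two] at h1 h2 h3
  have h4 : An.x G 1 0 = (An.x G 0 1 : A2 G) := add_left_cancel (h3.trans h1.symm)
  refine ⟨?_, h4⟩
  have h5 : An.x G 1 0 + An.x G 1 1 = (An.x G 0 1 + An.x G 0 0 : A2 G) :=
    h2.trans (h1.symm.trans (add_comm _ _))
  rw [h4] at h5
  exact add_left_cancel h5

theorem x_mul (i j k : Fin 2) :
    (An.x G i j * An.x G i k : A2 G) = if j = k then An.x G i j else 0 := by
  simp [An.x, An.a_row]

theorem commute_nu (i k l : Fin 2) (g : G) : Commute (An.nu i g) (An.x G k l : A2 G) := by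
  have h : ∀ l, Commute (An.nu i g) (An.x G i l : A2 G) := fun l => by
    simp [Commute, SemiconjBy, An.nu, An.x, Finset.sum_mul, Finset.mul_sum, An.a_row, -Fin.sum_univ_two]
  obtain ⟨e1, e2⟩ := x_eq G
  fin_cases i <;> fin_cases k <;> fin_cases l <;>
    first
    | exact h _
    | (simp only [Fin.mk_one, Fin.zero_eta, Fin.isValue] at h ⊢
       first
       | (rw [e1]; exact h _)
       | (rw [e2]; exact h _)
       | (rw [← e1]; exact h _)
       | (rw [← e2]; exact h _))

theorem commute_emb (z : Monoid.Coprod G G) (k l : Fin 2) : Commute (emb z) (An.x G k l : A2 G) := by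
  induction z using Monoid.Coprod.induction_on with
  | inl g => simpa [emb] using commute_nu 0 k l g
  | inr g => simpa [emb] using commute_nu 1 k l g
  | mul y z hy hz => rw [map_mul]; exact hy.mul_left hz

theorem vMatrix_apply (z : Monoid.Coprod G G) (i j : Fin 2) :
    vMatrix z i j = emb (if i = 0 then z else tau z) * An.x G i j := by
  fin_cases i <;> fin_cases j <;> simp [vMatrix]

theorem vMatrix_mul (y z : Monoid.Coprod G G) (i j k : Fin 2) :
    vMatrix y i j * vMatrix z i k = if j = k then vMatrix (y * z) i j else 0 := by
  have h : (if i = 0 then y * z else tau (y * z)) =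
      (if i = 0 then y else tau y) * (if i = 0 then z else tau z) := by
    split_ifs
    · rfl
    · exact map_mul ..
  rw [vMatrix_apply, vMatrix_apply, vMatrix_apply, h, map_mul, mul_assoc,
    ← mul_assoc (An.x G i j), ← (commute_emb _ i j).eq, mul_assoc, x_mul]
  split_ifs <;> simp [mul_assoc]

theorem vMatrix_inl (g : G) (i j : Fin 2) : vMatrix (Monoid.Coprod.inl g) i j = An.a i j g := by
  rw [vMatrix_apply]
  fin_cases i <;> simp [emb, tau, An.nu, An.x, Finset.sum_mul, An.a_row, -Fin.sum_univ_two]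

theorem vMatrix_inr (g : G) (i j : Fin 2) :
    vMatrix (Monoid.Coprod.inr g) i j = An.a (1 - i) (1 - j) g := by
  obtain ⟨e1, e2⟩ := x_eq G
  have h : ∀ i k, An.nu i g * An.x G i k = (An.a i k g : A2 G) := fun i k => by
    simp [An.nu, An.x, Finset.sum_mul, An.a_row, -Fin.sum_univ_two]
  rw [vMatrix_apply, ← h]
  fin_cases i <;> fin_cases j <;> simp [emb, tau, e1, e2]

theorem comul_vMatrix (z : Monoid.Coprod G G) (i j : Fin 2) :
    Coalgebra.comul (R := ℂ) (vMatrix z i j) = ∑ k, vMatrix z i k ⊗ₜ[ℂ] vMatrix z k j := by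
  induction z using Monoid.Coprod.induction_on generalizing i j with
  | inl g => simp only [vMatrix_inl, An.comul_a]
  | inr g =>
    simp only [vMatrix_inr, An.comul_a]
    fin_cases i <;> fin_cases j <;> simp [Fin.sum_univ_two, add_comm]
  | mul y z hy hz =>
    have h := vMatrix_mul y z i j j
    rw [if_pos rfl] at h
    rw [← h, Bialgebra.comul_mul, hy, hz]
    simp only [Finset.sum_mul_sum, Algebra.TensorProduct.tmul_mul_tmul, vMatrix_mul,
      TensorProduct.ite_tmul, Finset.sum_ite_eq, Finset.mem_univ, if_true]

theorem counit_vMatrix (z : Monoid.Coprod G G) (i j : Fin 2) :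
    Coalgebra.counit (R := ℂ) (vMatrix z i j) = if i = j then 1 else 0 := by
  induction z using Monoid.Coprod.induction_on generalizing i j with
  | inl g => simp only [vMatrix_inl, An.counit_a]
  | inr g =>
    simp only [vMatrix_inr, An.counit_a]
    fin_cases i <;> fin_cases j <;> simp
  | mul y z hy hz =>
    have h := vMatrix_mul y z i j j
    rw [if_pos rfl] at h
    rw [← h, Bialgebra.counit_mul, hy, hz]
    split_ifs <;> simp

theorem isGroupLikeElem_d : IsGroupLikeElem ℂ (An.x G 0 0 - An.x G 0 1 : A2 G) where
  counit_eq_one := by simp [An.x, An.counit_a]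
  comul_eq_tmul_self := by
    obtain ⟨e1, e2⟩ := x_eq G
    have h : ∀ i j, Coalgebra.comul (R := ℂ) (An.x G i j : A2 G) =
        An.x G i 0 ⊗ₜ[ℂ] An.x G 0 j + An.x G i 1 ⊗ₜ[ℂ] An.x G 1 j := fun i j => by
      rw [An.x, An.comul_a, Fin.sum_univ_two]; rfl
    rw [map_sub, h, h, e1, e2]
    simp only [TensorProduct.sub_tmul, TensorProduct.tmul_sub]
    abel

/-- The two-dimensional corepresentation `v x` of `𝒜₂(G)`, for `x` in `G * G`, given by the matrix
`A(x)`. -/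
def v (x : Monoid.Coprod G G) : Corepresentation (A2 G) (Fin 2 → ℂ) :=
  .ofMatrix (vMatrix x) (comul_vMatrix x) (counit_vMatrix x)

variable (G) in
/-- The one-dimensional corepresentation `d` of `𝒜₂(G)`, given by the group-like element
`x₁₁ - x₁₂`. -/
def d : Corepresentation (A2 G) ℂ :=
  .ofGroupLike (An.x G 0 0 - An.x G 0 1) isGroupLikeElem_d

end A2

end

/-!
The entries of the first rows of the matrices `vMatrix z`, `z` in `G * G`, form a linear basis of
`𝒜₂(G)` (`A2.basis`). They span because the products of such entries are again such entries or zero,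
and they are independent because they have independent images under an algebra map to two copies of
the group algebra of `G * G` (`A2.toGroupAlgebras`). The second row of `vMatrix z` consists of
entries of `vMatrix (tau z)`, so as a coalgebra `𝒜₂(G)` is the sum, over the orbits `{z, tau z}`, of
the spans of the entries of `vMatrix z`. Reduced words show that `tau z = z` only for `z = 1`
(`A2.eq_one_of_tau_eq`). Hence for `z ≠ 1` the span is a full `2 × 2` matrix coalgebra, while for
`z = 1` it is spanned by the group-like elements `1` and `x₁₁ - x₁₂`.

Functionals on `𝒜₂(G)` act on every corepresentation, multiplicatively for the convolution product
(`Corepresentation.act_act`). The coordinate functionals act on `v z`, `z ≠ 1`, as matrix units,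
which gives irreducibility (`A2.isIrreducible_v`), and they separate the `v z` up to `tau`
(`A2.iso_v_iff`). Their convolution products (`A2.conv_coord`) show that every nonzero
corepresentation receives a nonzero intertwiner from some `v z` (`A2.exists_isIntertwiner_v`). With
Schur's lemma and `v 1 ≅ ℂ ⊕ d` (`A2.directSum_trivial_d_iso_v_one`) this is the classification.

The fusion rules come from `v x ⊗ v y ≅ v (x y) ⊕ v (x τ(y))`, valid for all `x` and `y`
(`A2.tensor_v_iso`); when one of the products is `1`, the summand `v 1` splits further.
-/

noncomputable section

/-! ### Intertwiners -/

namespace Corepresentation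

variable {A : Type*} [Ring A] [Bialgebra ℂ A]
variable {V : Type*} [AddCommGroup V] [Module ℂ V]
variable {W : Type*} [AddCommGroup W] [Module ℂ W]
variable {V' : Type*} [AddCommGroup V'] [Module ℂ V']
variable {W' : Type*} [AddCommGroup W'] [Module ℂ W']

/-- A linear map is an intertwiner if it commutes with the coactions. -/
def IsIntertwiner (ρ : Corepresentation A V) (σ : Corepresentation A W) (f : V →ₗ[ℂ] W) : Prop :=
  σ.coact ∘ₗ f = f.rTensor A ∘ₗ ρ.coact

theorem IsIntertwiner.apply {ρ : Corepresentation A V} {σ : Corepresentation A W} {f : V →ₗ[ℂ] W}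
    (hf : IsIntertwiner ρ σ f) (v : V) : σ.coact (f v) = f.rTensor A (ρ.coact v) :=
  LinearMap.congr_fun hf v

theorem IsIntertwiner.comp {ρ : Corepresentation A V} {σ : Corepresentation A W}
    {π : Corepresentation A V'} {g : W →ₗ[ℂ] V'} {f : V →ₗ[ℂ] W}
    (hg : IsIntertwiner σ π g) (hf : IsIntertwiner ρ σ f) : IsIntertwiner ρ π (g ∘ₗ f) := by
  ext v
  simp only [LinearMap.comp_apply, hg.apply, hf.apply, LinearMap.rTensor_comp]

theorem IsIntertwiner.isInvariant_range {ρ : Corepresentation A V} {σ : Corepresentation A W}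
    {f : V →ₗ[ℂ] W} (hf : IsIntertwiner ρ σ f) : σ.IsInvariant (LinearMap.range f) := by
  rintro _ ⟨v, rfl⟩
  refine ⟨f.rangeRestrict.rTensor A (ρ.coact v), ?_⟩
  rw [hf.apply, ← LinearMap.comp_apply, ← LinearMap.rTensor_comp, LinearMap.subtype_comp_codRestrict]

/-- The kernel is invariant because `- ⊗ A` is exact over a field. -/
theorem IsIntertwiner.isInvariant_ker {ρ : Corepresentation A V} {σ : Corepresentation A W}
    {f : V →ₗ[ℂ] W} (hf : IsIntertwiner ρ σ f) : ρ.IsInvariant (LinearMap.ker f) := by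
  intro v hv
  have h := Module.Flat.rTensor_exact A (LinearMap.exact_subtype_ker_map f)
  refine (h _).1 ?_
  rw [← hf.apply, LinearMap.mem_ker.1 hv, map_zero]

theorem IsIntertwiner.iso {ρ : Corepresentation A V} {σ : Corepresentation A W}
    {f : V →ₗ[ℂ] W} (hf : IsIntertwiner ρ σ f) (hb : Function.Bijective f) : ρ.Iso σ :=
  ⟨LinearEquiv.ofBijective f hb, hf⟩

/-- Schur's lemma. -/
theorem IsIntertwiner.iso_of_ne_zero {ρ : Corepresentation A V} {σ : Corepresentation A W}
    {f : V →ₗ[ℂ] W} (hf : IsIntertwiner ρ σ f) (hρ : ρ.IsIrreducible) (hσ : σ.IsIrreducible)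
    (h0 : f ≠ 0) : ρ.Iso σ := by
  refine hf.iso ⟨?_, ?_⟩
  · refine LinearMap.ker_eq_bot.1 ((hρ.2 _ hf.isInvariant_ker).resolve_right fun h => h0 ?_)
    exact LinearMap.ker_eq_top.1 h
  · refine LinearMap.range_eq_top.1 ((hσ.2 _ hf.isInvariant_range).resolve_left fun h => h0 ?_)
    exact LinearMap.range_eq_bot.1 h

theorem Iso.refl (ρ : Corepresentation A V) : ρ.Iso ρ :=
  ⟨LinearEquiv.refl ℂ V, by ext; simp⟩

theorem Iso.symm {ρ : Corepresentation A V} {σ : Corepresentation A W} (h : ρ.Iso σ) :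
    σ.Iso ρ := by
  obtain ⟨e, he⟩ := h
  refine ⟨e.symm, LinearMap.ext fun w => ?_⟩
  obtain ⟨v, rfl⟩ := e.surjective w
  have h1 := LinearMap.congr_fun he v
  simp only [LinearMap.comp_apply, LinearEquiv.coe_coe, LinearEquiv.symm_apply_apply] at h1 ⊢
  rw [h1, ← LinearMap.comp_apply, ← LinearMap.rTensor_comp]
  simp

theorem Iso.trans {ρ : Corepresentation A V} {σ : Corepresentation A W}
    {π : Corepresentation A V'} (h₁ : ρ.Iso σ) (h₂ : σ.Iso π) : ρ.Iso π := by
  obtain ⟨e₁, he₁⟩ := h₁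
  obtain ⟨e₂, he₂⟩ := h₂
  exact ⟨e₁.trans e₂, IsIntertwiner.comp he₂ he₁⟩

theorem isIntertwiner_coprod {ρ : Corepresentation A V} {σ : Corepresentation A W}
    {π : Corepresentation A V'} {f : V →ₗ[ℂ] V'} {g : W →ₗ[ℂ] V'}
    (hf : IsIntertwiner ρ π f) (hg : IsIntertwiner σ π g) :
    IsIntertwiner (ρ.directSum σ) π (f.coprod g) := by
  refine LinearMap.prod_ext ?_ ?_ <;> ext v
  · simp only [LinearMap.comp_apply, directSum, LinearMap.inl_apply,
      LinearMap.coprod_apply, map_zero, add_zero, hf.apply]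
    rw [← LinearMap.comp_apply (f := (f.coprod g).rTensor A), ← LinearMap.rTensor_comp,
      LinearMap.coprod_inl]
  · simp only [LinearMap.comp_apply, directSum, LinearMap.inr_apply,
      LinearMap.coprod_apply, map_zero, zero_add, hg.apply]
    rw [← LinearMap.comp_apply (f := (f.coprod g).rTensor A), ← LinearMap.rTensor_comp,
      LinearMap.coprod_inr]

theorem isIntertwiner_inl (ρ : Corepresentation A V) (σ : Corepresentation A W) :
    IsIntertwiner ρ (ρ.directSum σ) (LinearMap.inl ℂ V W) :=
  LinearMap.coprod_inl ..

theorem isIntertwiner_inr (ρ : Corepresentation A V) (σ : Corepresentation A W) :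
    IsIntertwiner σ (ρ.directSum σ) (LinearMap.inr ℂ V W) :=
  LinearMap.coprod_inr ..

theorem Iso.directSum {ρ : Corepresentation A V} {σ : Corepresentation A W}
    {ρ' : Corepresentation A V'} {σ' : Corepresentation A W'} (h₁ : ρ.Iso ρ') (h₂ : σ.Iso σ') :
    (ρ.directSum σ).Iso (ρ'.directSum σ') := by
  obtain ⟨e₁, he₁⟩ := h₁
  obtain ⟨e₂, he₂⟩ := h₂
  have h := isIntertwiner_coprod ((isIntertwiner_inl ρ' σ').comp he₁)
    ((isIntertwiner_inr ρ' σ').comp he₂)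
  refine h.iso ?_
  convert (e₁.prodCongr e₂).bijective using 1
  ext x <;> simp

/-! ### Corepresentations given by matrices and by group-like elements -/

theorem ofMatrix_coact_single {ι : Type*} [Fintype ι] [DecidableEq ι] (u : Matrix ι ι A)
    (hΔ hε) (j : ι) :
    (ofMatrix u hΔ hε).coact (Pi.single j 1) = ∑ i, Pi.single i (1 : ℂ) ⊗ₜ[ℂ] u i j := by
  simp only [ofMatrix]
  rw [← Pi.basisFun_apply, Module.Basis.constr_basis]

theorem isIntertwiner_ofMatrix {ι : Type*} [Fintype ι] [DecidableEq ι] {u : Matrix ι ι A}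
    {hΔ hε} {σ : Corepresentation A W} {f : (ι → ℂ) →ₗ[ℂ] W}
    (h : ∀ j, σ.coact (f (Pi.single j 1)) = ∑ i, f (Pi.single i 1) ⊗ₜ[ℂ] u i j) :
    IsIntertwiner (ofMatrix u hΔ hε) σ f := by
  refine (Pi.basisFun ℂ ι).ext fun j => ?_
  simp only [Pi.basisFun_apply, LinearMap.comp_apply, ofMatrix_coact_single, h, map_sum,
    LinearMap.rTensor_tmul]

theorem ofGroupLike_coact (g : A) (hg : IsGroupLikeElem ℂ g) (z : ℂ) :
    (ofGroupLike g hg).coact z = z ⊗ₜ[ℂ] g := rfl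

theorem isIntertwiner_ofGroupLike {g : A} {hg : IsGroupLikeElem ℂ g} {σ : Corepresentation A W}
    {f : ℂ →ₗ[ℂ] W} (h : σ.coact (f 1) = f 1 ⊗ₜ[ℂ] g) :
    IsIntertwiner (ofGroupLike g hg) σ f := by
  ext
  simpa [ofGroupLike_coact] using h

theorem tensor_coact_tmul (ρ : Corepresentation A V) (σ : Corepresentation A W) (v : V) (w : W) :
    (ρ.tensor σ).coact (v ⊗ₜ[ℂ] w) = mulCoeff V W A (ρ.coact v ⊗ₜ[ℂ] σ.coact w) := rfl

theorem isIrreducible_of_complex (ρ : Corepresentation A ℂ) : ρ.IsIrreducible :=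
  ⟨inferInstance, fun U _ => eq_bot_or_eq_top U⟩

/-! ### The action of functionals -/

/-- The action `v ↦ (id ⊗ f) (ρ v)` of a functional `f` on `A` on the space of a
corepresentation. -/
def act (ρ : Corepresentation A V) (f : A →ₗ[ℂ] ℂ) : V →ₗ[ℂ] V :=
  (TensorProduct.rid ℂ V).toLinearMap ∘ₗ f.lTensor V ∘ₗ ρ.coact

theorem act_zero (ρ : Corepresentation A V) : ρ.act 0 = 0 := by
  simp [act]

theorem IsInvariant.act_mem {ρ : Corepresentation A V} {U : Submodule ℂ V} (hU : ρ.IsInvariant U)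
    (f : A →ₗ[ℂ] ℂ) {u : V} (hu : u ∈ U) : ρ.act f u ∈ U := by
  obtain ⟨t, ht⟩ := hU u hu
  rw [act, LinearMap.comp_apply, LinearMap.comp_apply, ← ht]
  clear ht
  induction t with
  | zero => simp
  | add t s h h' => simpa only [map_add] using U.add_mem h h'
  | tmul v a => simpa using U.smul_mem _ v.2

theorem IsIntertwiner.act {ρ : Corepresentation A V} {σ : Corepresentation A W}
    {e : V →ₗ[ℂ] W} (he : IsIntertwiner ρ σ e) (f : A →ₗ[ℂ] ℂ) (v : V) :
    σ.act f (e v) = e (ρ.act f v) := by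
  simp only [Corepresentation.act, LinearMap.comp_apply, he.apply]
  generalize ρ.coact v = t
  induction t with
  | zero => simp
  | add t s h h' => simp only [map_add, h, h']
  | tmul v a => simp

theorem act_ofMatrix_single {ι : Type*} [Fintype ι] [DecidableEq ι] (u : Matrix ι ι A)
    (hΔ hε) (f : A →ₗ[ℂ] ℂ) (j : ι) :
    (ofMatrix u hΔ hε).act f (Pi.single j 1) = ∑ i, f (u i j) • Pi.single i (1 : ℂ) := by
  simp only [act, LinearMap.comp_apply, ofMatrix_coact_single, map_sum, LinearMap.lTensor_tmul,
    LinearEquiv.coe_coe, TensorProduct.rid_tmul]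

/-- The convolution product of two functionals on `A`. -/
def conv (f g : A →ₗ[ℂ] ℂ) : A →ₗ[ℂ] ℂ :=
  LinearMap.mul' ℂ ℂ ∘ₗ TensorProduct.map f g ∘ₗ Coalgebra.comul

/-- By coassociativity, functionals act multiplicatively for the convolution product. -/
theorem act_act (ρ : Corepresentation A V) (f g : A →ₗ[ℂ] ℂ) (v : V) :
    ρ.act f (ρ.act g v) = ρ.act (conv f g) v := by
  have h := LinearMap.congr_fun ρ.coassoc v
  simp only [LinearMap.comp_apply, LinearEquiv.coe_coe] at h
  have h1 := congrArg (fun t => TensorProduct.rid ℂ V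
    ((LinearMap.mul' ℂ ℂ ∘ₗ TensorProduct.map f g).lTensor V t)) h
  rw [← LinearMap.comp_apply (LinearMap.lTensor V _) (LinearMap.lTensor V _),
    ← LinearMap.lTensor_comp, LinearMap.comp_assoc] at h1
  refine Eq.trans ?_ h1
  simp only [act, LinearMap.comp_apply, LinearEquiv.coe_coe]
  generalize ρ.coact v = t
  induction t with
  | zero => simp
  | add t s h h' => simp only [map_add, h, h']
  | tmul w a =>
    simp only [LinearMap.rTensor_tmul, LinearMap.lTensor_tmul, TensorProduct.rid_tmul, map_smul]
    generalize ρ.coact w = t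
    induction t with
    | zero => simp
    | add t s h h' => simp only [map_add, TensorProduct.add_tmul, smul_add, h, h']
    | tmul w b => simp [smul_smul, mul_comm]

/-- The coefficients of `t` in a basis of `A` determine `t`. -/
theorem ext_of_coord {κ : Type*} (b : Module.Basis κ ℂ A) {t s : V ⊗[ℂ] A}
    (h : ∀ k, TensorProduct.rid ℂ V ((b.coord k).lTensor V t) =
      TensorProduct.rid ℂ V ((b.coord k).lTensor V s)) : t = s := by
  classical
  refine (TensorProduct.equivFinsuppOfBasisRight b).injective (Finsupp.ext fun k => ?_)
  rw [TensorProduct.equivFinsuppOfBasisRight_apply, TensorProduct.equivFinsuppOfBasisRight_apply, h]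

end Corepresentation

/-! ### The fixed points of the exchange automorphism -/

namespace Monoid.CoprodI

variable {G : Type*} [Group G]

/-- The reduced word in two copies of `G` obtained by moving each letter to the other copy. -/
def Word.exchange (w : Word fun _ : Fin 2 => G) : Word fun _ : Fin 2 => G where
  toList := w.toList.map fun l => ⟨1 - l.1, l.2⟩
  ne_one l hl := by
    obtain ⟨l', hl', rfl⟩ := List.mem_map.1 hl
    exact w.ne_one l' hl'
  chain_ne := by
    rw [List.isChain_map]
    exact w.chain_ne.imp fun l l' h => by simpa using h

theorem Word.prod_exchange (w : Word fun _ : Fin 2 => G) :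
    w.exchange.prod =
      lift (fun i => of (M := fun _ : Fin 2 => G) (i := 1 - i)) w.prod := by
  simp only [Word.prod, Word.exchange, map_list_prod, List.map_map]
  congr 1

/-- A nonempty reduced word is moved by the exchange of the copies, because its first letter changes
copy. -/
theorem eq_one_of_exchange_eq (x : CoprodI fun _ : Fin 2 => G)
    (h : lift (fun i => of (M := fun _ : Fin 2 => G) (i := 1 - i)) x = x) : x = 1 := by
  classical
  obtain ⟨w, rfl⟩ := (Word.equiv (M := fun _ : Fin 2 => G)).symm.surjective x
  change lift _ w.prod = w.prod at h
  change w.prod = 1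
  rw [← Word.prod_exchange] at h
  have hw : w.exchange = w := (Word.equiv (M := fun _ : Fin 2 => G)).symm.injective h
  have hl := congrArg Word.toList hw
  rcases hw' : w.toList with - | ⟨l, t⟩
  · simp [Word.prod, hw']
  · simp only [Word.exchange, hw', List.map_cons, List.cons.injEq] at hl
    have h1 : 1 - l.1 = l.1 := congrArg Sigma.fst hl.1
    generalize l.1 = i at h1
    fin_cases i <;> simp at h1

end Monoid.CoprodI

namespace A2

variable {G : Type*} [Group G]

theorem tau_tau (x : Monoid.Coprod G G) : tau (tau x) = x := Monoid.Coprod.swap_swap x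

theorem eq_one_of_tau_eq {x : Monoid.Coprod G G} (h : tau x = x) : x = 1 := by
  let φ : Monoid.Coprod G G →* Monoid.CoprodI fun _ : Fin 2 => G :=
    Monoid.Coprod.lift (Monoid.CoprodI.of (M := fun _ : Fin 2 => G) (i := 0))
      (Monoid.CoprodI.of (M := fun _ : Fin 2 => G) (i := 1))
  let ψ : (Monoid.CoprodI fun _ : Fin 2 => G) →* Monoid.Coprod G G :=
    Monoid.CoprodI.lift fun i => if i = 0 then Monoid.Coprod.inl else Monoid.Coprod.inr
  have hψφ : ψ.comp φ = .id _ := by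
    refine Monoid.Coprod.hom_ext ?_ ?_ <;> ext g <;> simp [φ, ψ]
  have hφ : φ.comp tau = (Monoid.CoprodI.lift fun i =>
      Monoid.CoprodI.of (M := fun _ : Fin 2 => G) (i := 1 - i)).comp φ := by
    refine Monoid.Coprod.hom_ext ?_ ?_ <;> ext g <;> simp [φ, tau]
  have h1 := DFunLike.congr_fun hφ x
  simp only [MonoidHom.comp_apply, h] at h1
  have h2 := DFunLike.congr_fun hψφ x
  rw [MonoidHom.comp_apply, Monoid.CoprodI.eq_one_of_exchange_eq _ h1.symm, map_one] at h2
  exact h2.symm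

/-! ### A basis of `𝒜₂(G)` -/

/-- The inclusion of the `i`-th copy of `G` in `G * G`. -/
def letter (i : Fin 2) : G →* Monoid.Coprod G G :=
  if i = 0 then Monoid.Coprod.inl else Monoid.Coprod.inr

/-- The algebra map from `𝒜₂(G)` to two copies of the group algebra of `G * G` that sends
`a i j (g)` to `g`, taken in the `i`-th copy of `G`, placed in the first factor if `i = j` and in
the second factor otherwise. -/
def toGroupAlgebras : A2 G →ₐ[ℂ]
    MonoidAlgebra ℂ (Monoid.Coprod G G) × MonoidAlgebra ℂ (Monoid.Coprod G G) :=
  An.lift (fun i j g => if i = j then (MonoidAlgebra.of ℂ _ (letter i g), 0)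
      else (0, MonoidAlgebra.of ℂ _ (letter i g)))
    (fun i j k g h => by
      fin_cases i <;> fin_cases j <;> fin_cases k <;> simp [MonoidAlgebra.single_mul_single])
    (fun i j k g h => by
      fin_cases i <;> fin_cases j <;> fin_cases k <;> simp [MonoidAlgebra.single_mul_single])
    (fun i => by fin_cases i <;> simp <;> rfl)
    (fun i => by fin_cases i <;> simp <;> rfl)

theorem toGroupAlgebras_a (i j : Fin 2) (g : G) :
    toGroupAlgebras (An.a i j g) = if i = j then (MonoidAlgebra.of ℂ _ (letter i g), 0)
      else (0, MonoidAlgebra.of ℂ _ (letter i g)) := An.lift_a ..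

theorem toGroupAlgebras_emb (z : Monoid.Coprod G G) :
    toGroupAlgebras (emb z) = (MonoidAlgebra.of ℂ _ z, MonoidAlgebra.of ℂ _ z) := by
  have h : ((toGroupAlgebras (G := G) : A2 G →* _).comp emb) =
      (MonoidAlgebra.of ℂ (Monoid.Coprod G G)).prod (MonoidAlgebra.of ℂ _) := by
    refine Monoid.Coprod.hom_ext ?_ ?_ <;> ext1 g <;>
      simp [emb, An.nu, toGroupAlgebras_a, letter]
  exact DFunLike.congr_fun h z

theorem toGroupAlgebras_vMatrix (z : Monoid.Coprod G G) (j : Fin 2) :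
    toGroupAlgebras (vMatrix z 0 j) = if j = 0 then (MonoidAlgebra.of ℂ _ z, 0)
      else (0, MonoidAlgebra.of ℂ _ z) := by
  rw [vMatrix_apply, map_mul, toGroupAlgebras_emb, An.x, toGroupAlgebras_a]
  fin_cases j <;> simp [MonoidAlgebra.single_mul_single]

theorem vMatrix_tau (z : Monoid.Coprod G G) (i j : Fin 2) :
    vMatrix (tau z) i j = vMatrix z (1 - i) (1 - j) := by
  obtain ⟨e1, e2⟩ := x_eq G
  fin_cases i <;> fin_cases j <;> simp [vMatrix, tau_tau, e1, e2]

theorem linearIndependent_vMatrix :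
    LinearIndependent ℂ fun p : Monoid.Coprod G G × Fin 2 => vMatrix p.1 0 p.2 := by
  classical
  refine LinearIndependent.of_pairwise_dual_eq_zero_one _ (fun p =>
    (Finsupp.lapply p.1 ∘ₗ (MonoidAlgebra.coeffLinearEquiv ℂ).toLinearMap) ∘ₗ
      (if p.2 = 0 then LinearMap.fst ℂ _ _ else LinearMap.snd ℂ _ _) ∘ₗ
        toGroupAlgebras.toLinearMap) ?_ ?_
  · rintro ⟨z, i⟩ ⟨w, j⟩ h
    fin_cases i <;> fin_cases j <;>
      simp_all [toGroupAlgebras_vMatrix, eq_comm]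
  · rintro ⟨z, i⟩
    fin_cases i <;> simp [toGroupAlgebras_vMatrix]

theorem span_vMatrix :
    Submodule.span ℂ (Set.range fun p : Monoid.Coprod G G × Fin 2 => vMatrix p.1 0 p.2) = ⊤ := by
  set S := Submodule.span ℂ (Set.range fun p : Monoid.Coprod G G × Fin 2 => vMatrix p.1 0 p.2)
  have hmem : ∀ z i j, vMatrix z i j ∈ S := fun z i j => by
    fin_cases i
    · exact Submodule.subset_span ⟨(z, j), rfl⟩
    · have h := vMatrix_tau (tau z) 1 j
      rw [tau_tau] at h
      exact Submodule.subset_span ⟨(tau z, 1 - j), h.symm⟩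
  have hone : (1 : A2 G) ∈ S := by
    have h := An.a_row_sum (n := 2) (G := G) 0
    rw [← h]
    exact S.sum_mem fun l _ => by rw [← vMatrix_inl]; exact hmem _ _ _
  have hmul : ∀ x y, x ∈ S → y ∈ S → x * y ∈ S := by
    intro x y hx hy
    induction hx, hy using Submodule.span_induction₂ with
    | mem_mem x y hx hy =>
      obtain ⟨⟨z, i⟩, rfl⟩ := hx
      obtain ⟨⟨w, j⟩, rfl⟩ := hy
      simp only [vMatrix_mul]
      split_ifs
      · exact hmem _ _ _
      · exact S.zero_mem
    | zero_left => simp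
    | zero_right => simp
    | add_left x y z _ _ _ h h' => rw [add_mul]; exact S.add_mem h h'
    | add_right x y z _ _ _ h h' => rw [mul_add]; exact S.add_mem h h'
    | smul_left r x y _ _ h => rw [smul_mul_assoc]; exact S.smul_mem _ h
    | smul_right r x y _ _ h => rw [mul_smul_comm]; exact S.smul_mem _ h
  let B : Subalgebra ℂ (A2 G) := S.toSubalgebra hone hmul
  let φ : A2 G →ₐ[ℂ] B := An.lift (fun i j g => ⟨An.a i j g, by
      rw [← vMatrix_inl]; exact hmem _ _ _⟩)
    (fun i j k g h => Subtype.ext (by simpa [apply_ite Subtype.val] using An.a_row i j k g h))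
    (fun i j k g h => Subtype.ext (by simpa [apply_ite Subtype.val] using An.a_col i j k g h))
    (fun i => Subtype.ext (by simpa using An.a_row_sum (n := 2) (G := G) i))
    (fun i => Subtype.ext (by simpa using An.a_col_sum (n := 2) (G := G) i))
  have hφ : B.val.comp φ = AlgHom.id ℂ _ :=
    An.algHom_ext fun i j g => congrArg B.val (An.lift_a ..)
  refine eq_top_iff.2 fun x _ => ?_
  have h := (φ x).2
  rwa [show ((φ x : B) : A2 G) = x from DFunLike.congr_fun hφ x] at h

variable (G) in
/-- The basis of `𝒜₂(G)` formed by the first rows of the matrices `vMatrix z`, `z` in `G * G`. -/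
def basis : Module.Basis (Monoid.Coprod G G × Fin 2) ℂ (A2 G) :=
  .mk linearIndependent_vMatrix span_vMatrix.ge

theorem basis_apply (z : Monoid.Coprod G G) (j : Fin 2) : basis G (z, j) = vMatrix z 0 j :=
  Module.Basis.mk_apply ..

open Classical in
theorem repr_vMatrix (z w : Monoid.Coprod G G) (j k l : Fin 2) :
    (basis G).repr (vMatrix w k l) (z, j) =
      if k = 0 then (if z = w ∧ j = l then 1 else 0)
      else (if z = tau w ∧ j = 1 - l then 1 else 0) := by
  have h : ∀ w l, (basis G).repr (vMatrix w 0 l) (z, j) = if z = w ∧ j = l then 1 else 0 :=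
    fun w l => by
      rw [← basis_apply, Module.Basis.repr_self, Finsupp.single_apply]
      simp only [Prod.mk.injEq, eq_comm]
  have hk : k = 0 ∨ k = 1 := by omega
  rcases hk with rfl | rfl
  · rw [h, if_pos rfl]
  · have e := vMatrix_tau (tau w) 1 l
    rw [tau_tau, sub_self] at e
    rw [e, h, if_neg one_ne_zero]

end A2

namespace A2

variable {G : Type*} [Group G]

/-! ### Irreducibility and isomorphisms -/

open Corepresentation

theorem act_v_zero (x : Monoid.Coprod G G) (f : A2 G →ₗ[ℂ] ℂ) (c : Fin 2 → ℂ) :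
    (v x).act f c 0 = f (vMatrix x 0 0) * c 0 + f (vMatrix x 0 1) * c 1 := by
  have hc : c = c 0 • Pi.single 0 1 + c 1 • Pi.single 1 1 := by
    ext i; fin_cases i <;> simp
  rw [hc, map_add, map_smul, map_smul, v, act_ofMatrix_single, act_ofMatrix_single]
  simp [mul_comm]

theorem act_v_one (x : Monoid.Coprod G G) (f : A2 G →ₗ[ℂ] ℂ) (c : Fin 2 → ℂ) :
    (v x).act f c 1 = f (vMatrix x 1 0) * c 0 + f (vMatrix x 1 1) * c 1 := by
  have hc : c = c 0 • Pi.single 0 1 + c 1 • Pi.single 1 1 := by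
    ext i; fin_cases i <;> simp
  rw [hc, map_add, map_smul, map_smul, v, act_ofMatrix_single, act_ofMatrix_single]
  simp [mul_comm]

/-- For `x ≠ 1` the four entries of `vMatrix x` are distinct basis vectors, so their coordinate
functionals act as the four matrix units. -/
theorem isIrreducible_v {x : Monoid.Coprod G G} (hx : x ≠ 1) : (v x).IsIrreducible := by
  have hτ : tau x ≠ x := fun h => hx (eq_one_of_tau_eq h)
  refine ⟨inferInstance, fun U hU => or_iff_not_imp_left.2 fun hbot => ?_⟩
  obtain ⟨c, hcU, hc⟩ := U.ne_bot_iff.1 hbot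
  have hunit : ∀ i j, c j • (Pi.single i 1 : Fin 2 → ℂ) ∈ U := fun i j => by
    have h := hU.act_mem ((basis G).coord (if i = 0 then x else tau x, if i = 0 then j else 1 - j))
      hcU
    convert h using 1
    ext k
    fin_cases i <;> fin_cases j <;> fin_cases k <;>
      simp [act_v_zero, act_v_one, repr_vMatrix, hτ, hτ.symm]
  obtain ⟨j, hj⟩ : ∃ j, c j ≠ 0 := by
    by_contra! h
    exact hc (funext h)
  have hs : ∀ i, (Pi.single i 1 : Fin 2 → ℂ) ∈ U := fun i => by
    simpa [smul_smul, hj] using U.smul_mem (c j)⁻¹ (hunit i j)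
  refine eq_top_iff.2 fun u _ => ?_
  have hu : u = u 0 • Pi.single 0 1 + u 1 • Pi.single 1 1 := by
    ext i; fin_cases i <;> simp
  rw [hu]
  exact U.add_mem (U.smul_mem _ (hs 0)) (U.smul_mem _ (hs 1))

theorem iso_v_tau (x : Monoid.Coprod G G) : (v (tau x)).Iso (v x) := by
  have h : IsIntertwiner (v (tau x)) (v x)
      (LinearEquiv.funCongrLeft ℂ ℂ (Equiv.swap (0 : Fin 2) 1)).toLinearMap := by
    have hs : ∀ j : Fin 2, LinearEquiv.funCongrLeft ℂ ℂ (Equiv.swap (0 : Fin 2) 1) (Pi.single j 1) =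
        Pi.single (1 - j) 1 := fun j => by
      ext i; fin_cases i <;> fin_cases j <;> simp [LinearMap.funLeft]
    refine isIntertwiner_ofMatrix fun j => ?_
    simp only [LinearEquiv.coe_coe, hs]
    rw [v, ofMatrix_coact_single]
    fin_cases j <;> simp [vMatrix_tau, add_comm]
  exact h.iso (LinearEquiv.bijective _)

theorem iso_v_iff {x y : Monoid.Coprod G G} : (v x).Iso (v y) ↔ x = y ∨ x = tau y := by
  refine ⟨fun ⟨e, he⟩ => ?_, ?_⟩
  · by_contra! h
    obtain ⟨h1, h2⟩ := h
    have h3 : y ≠ tau x := fun h => h2 (by rw [h, tau_tau])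
    -- The functional dual to the entry `(1, 1)` of `v y` annihilates every entry of `v x`.
    have hx : ∀ c, (v x).act ((basis G).coord (y, 0)) c = 0 := fun c => by
      ext i
      fin_cases i <;> simp [act_v_zero, act_v_one, repr_vMatrix, h1.symm, h3]
    have hy := IsIntertwiner.act he ((basis G).coord (y, 0)) (e.symm (Pi.single 0 1))
    rw [hx, map_zero] at hy
    have := congrFun hy 0
    simp [act_v_zero, repr_vMatrix] at this
  · rintro (rfl | rfl)
    · exact Iso.refl _
    · exact iso_v_tau y

theorem not_iso_d_trivial : ¬ (d G).Iso (Corepresentation.trivial (A2 G)) := by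
  rintro ⟨e, he⟩
  -- The functional dual to `x₁₂` is `-1` on `x₁₁ - x₁₂` and `1` on `1 = x₁₁ + x₁₂`.
  have h := IsIntertwiner.act he ((basis G).coord (1, 1)) 1
  have hx : ∀ l, (An.x G 0 l : A2 G) = vMatrix 1 0 l := fun l => by simp [vMatrix_apply]
  have h1 : (1 : A2 G) = vMatrix 1 0 0 + vMatrix 1 0 1 := by
    rw [← hx, ← hx, ← An.a_row_sum (n := 2) (G := G) 0, Fin.sum_univ_two]; rfl
  have ht : (basis G).coord (1, 1) (1 : A2 G) = 1 := by
    rw [h1, map_add]; simp [repr_vMatrix]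
  have hd : (basis G).coord (1, 1) (An.x G 0 0 - An.x G 0 1 : A2 G) = -1 := by
    rw [hx, hx, map_sub]; simp [repr_vMatrix]
  simp only [act, LinearMap.comp_apply, d, Corepresentation.trivial, ofGroupLike_coact,
    LinearMap.lTensor_tmul, LinearEquiv.coe_coe, TensorProduct.rid_tmul, ht, hd,
    neg_smul, one_smul, map_neg] at h
  have h2 : e 1 = 0 := self_eq_neg.1 h
  exact one_ne_zero (e.map_eq_zero_iff.1 h2)

/-! ### The classification of irreducible corepresentations -/

open Classical in
theorem conv_coord (w z : Monoid.Coprod G G) (k j : Fin 2) :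
    conv ((basis G).coord (w, k)) ((basis G).coord (z, j)) =
      if k = 0 then (if w = z then (basis G).coord (z, j) else 0)
      else (if w = tau z then (basis G).coord (w, 1 - j) else 0) := by
  refine (basis G).ext fun ⟨y, l⟩ => ?_
  rw [basis_apply, conv, LinearMap.comp_apply, LinearMap.comp_apply, comul_vMatrix,
    Fin.sum_univ_two]
  simp only [map_add, TensorProduct.map_tmul, LinearMap.mul'_apply, Module.Basis.coord_apply,
    repr_vMatrix]
  have hk : k = 0 ∨ k = 1 := by omega
  rcases hk with rfl | rfl
  · by_cases hy : w = y
    · subst hy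
      by_cases h : w = z <;> simp [h, repr_vMatrix, eq_comm (a := z)]
    · by_cases h : w = z
      · subst h; simp [hy, repr_vMatrix]
      · simp [hy, h]
  · have hz : z = tau y ↔ y = tau z :=
      ⟨fun h => by rw [h, tau_tau], fun h => by rw [h, tau_tau]⟩
    have hj : j = 1 - l ↔ 1 - j = l := by omega
    by_cases hy : w = y
    · subst hy
      by_cases h : w = tau z <;> simp [h, hz, hj, repr_vMatrix, tau_tau]
    · by_cases h : w = tau z
      · subst h; simp [hy, repr_vMatrix]
      · simp [hy, h]

/-- Every nonzero corepresentation receives a nonzero map from some `v z`: with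
`w = (id ⊗ f) (ρ u)` for the functional `f` dual to the entry `(1, 1)` of `vMatrix z`, and
`w' = (id ⊗ f') (ρ u)` for the one dual to the entry `(2, 1)`, the map `e₁ ↦ w`, `e₂ ↦ w'`
intertwines. -/
theorem exists_isIntertwiner_v {V : Type*} [AddCommGroup V] [Module ℂ V] [Nontrivial V]
    (ρ : Corepresentation (A2 G) V) :
    ∃ z, ∃ f : (Fin 2 → ℂ) →ₗ[ℂ] V, IsIntertwiner (v z) ρ f ∧ f ≠ 0 := by
  obtain ⟨u, hu⟩ := exists_ne (0 : V)
  obtain ⟨z, hz⟩ : ∃ z, ρ.act ((basis G).coord (z, 0)) u ≠ 0 := by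
    by_contra! h
    have h0 : ρ.coact u = 0 := ext_of_coord (basis G) fun ⟨z, j⟩ => by
      have hj : j = 0 ∨ j = 1 := by omega
      rcases hj with rfl | rfl
      · simpa [act] using h z
      · -- The functional dual to `vMatrix z 0 1` is the convolution of itself with the one
        -- dual to `vMatrix (tau z) 0 0`, which kills `u`.
        have h1 := act_act ρ ((basis G).coord (z, 1)) ((basis G).coord (tau z, 0)) u
        rw [h, map_zero, conv_coord] at h1
        simpa [tau_tau, act] using h1.symm
    have h1 := ρ.counit_coact u
    rw [h0, map_zero] at h1
    have h2 := congrArg (TensorProduct.rid ℂ V) h1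
    rw [map_zero, TensorProduct.rid_tmul, one_smul] at h2
    exact hu h2.symm
  refine ⟨z, (Pi.basisFun ℂ (Fin 2)).constr ℂ ![ρ.act ((basis G).coord (z, 0)) u,
    ρ.act ((basis G).coord (tau z, 1)) u], ?_, fun h => hz ?_⟩
  · have hs : ∀ j, (Pi.basisFun ℂ (Fin 2)).constr ℂ ![ρ.act ((basis G).coord (z, 0)) u,
        ρ.act ((basis G).coord (tau z, 1)) u] (Pi.single j 1) =
        ![ρ.act ((basis G).coord (z, 0)) u, ρ.act ((basis G).coord (tau z, 1)) u] j := fun j => by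
      rw [← Pi.basisFun_apply, Module.Basis.constr_basis]
    refine isIntertwiner_ofMatrix fun j => ext_of_coord (basis G) fun ⟨y, l⟩ => ?_
    simp only [hs, map_add, LinearMap.lTensor_tmul, TensorProduct.rid_tmul, Fin.sum_univ_two,
      Module.Basis.coord_apply, repr_vMatrix]
    change ρ.act ((basis G).coord (y, l)) _ = _
    have hl : l = 0 ∨ l = 1 := by omega
    by_cases h₁ : y = z
    · subst h₁
      by_cases h₂ : y = tau y
      · fin_cases j <;> rcases hl with rfl | rfl <;>
          simp [act_act, conv_coord, ← h₂]
      · fin_cases j <;> rcases hl with rfl | rfl <;>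
          simp [act_act, conv_coord, tau_tau, act_zero, h₂]
    · by_cases h₂ : y = tau z
      · subst h₂
        fin_cases j <;> rcases hl with rfl | rfl <;>
          simp [act_act, conv_coord, tau_tau, act_zero, h₁]
      · fin_cases j <;> rcases hl with rfl | rfl <;>
          simp [act_act, conv_coord, tau_tau, act_zero, h₁, h₂]
  · have h1 := LinearMap.congr_fun h (Pi.single 0 1)
    rw [← Pi.basisFun_apply, Module.Basis.constr_basis] at h1
    simpa using h1

theorem mul_d (i j : Fin 2) : (An.x G i j * (An.x G 0 0 - An.x G 0 1) : A2 G) =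
    if i = j then An.x G i j else -An.x G i j := by
  obtain ⟨e1, e2⟩ := x_eq G
  fin_cases i <;> fin_cases j <;> simp [e1, e2, mul_sub, x_mul]

theorem d_mul_d : ((An.x G 0 0 - An.x G 0 1) * (An.x G 0 0 - An.x G 0 1) : A2 G) = 1 := by
  have h := An.a_row_sum (n := 2) (G := G) 0
  rw [Fin.sum_univ_two] at h
  rw [sub_mul, mul_d, mul_d]
  simpa [An.x] using h

/-- `v 1` decomposes along the basis `e₁ + e₂`, `e₁ - e₂` of `ℂ²`. -/
theorem directSum_trivial_d_iso_v_one :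
    ((Corepresentation.trivial (A2 G)).directSum (d G)).Iso (v 1) := by
  obtain ⟨e1, e2⟩ := x_eq G
  have h1 := An.a_row_sum (n := 2) (G := G) 0
  rw [Fin.sum_univ_two] at h1
  change An.x G 0 0 + An.x G 0 1 = (1 : A2 G) at h1
  have hc : ∀ j, (v (1 : Monoid.Coprod G G)).coact (Pi.single j 1) =
      ∑ i, Pi.single i (1 : ℂ) ⊗ₜ[ℂ] An.x G i j := fun j => by
    rw [v, ofMatrix_coact_single]
    simp [vMatrix_apply]
  have hf := isIntertwiner_coprod
    (isIntertwiner_ofGroupLike (g := (1 : A2 G)) (hg := .one) (σ := v 1)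
      (f := LinearMap.toSpanSingleton ℂ _ (Pi.single 0 1 + Pi.single 1 1)) (by
        simp only [LinearMap.toSpanSingleton_apply, one_smul, map_add, hc, Fin.sum_univ_two, e1, e2,
          ← h1, TensorProduct.add_tmul, TensorProduct.tmul_add]
        abel))
    (isIntertwiner_ofGroupLike (hg := isGroupLikeElem_d (G := G)) (σ := v 1)
      (f := LinearMap.toSpanSingleton ℂ _ (Pi.single 0 1 - Pi.single 1 1)) (by
        simp only [LinearMap.toSpanSingleton_apply, one_smul, map_sub, hc, Fin.sum_univ_two, e1, e2,
          TensorProduct.sub_tmul, TensorProduct.tmul_sub]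
        abel))
  refine IsIntertwiner.iso hf ?_
  have hinj : Function.Injective ((LinearMap.toSpanSingleton ℂ (Fin 2 → ℂ)
      (Pi.single 0 1 + Pi.single 1 1)).coprod (LinearMap.toSpanSingleton ℂ (Fin 2 → ℂ)
      (Pi.single 0 1 - Pi.single 1 1))) := by
    refine (injective_iff_map_eq_zero _).2 fun ⟨a, b⟩ h => ?_
    have h0 : a + b = 0 := by simpa using congrFun h 0
    have h1 : a + -b = 0 := by simpa using congrFun h 1
    have hb : b = 0 := by linear_combination (h0 - h1) / 2
    simp_all
  exact ⟨hinj, (LinearMap.injective_iff_surjective_of_finrank_eq_finrank (by simp)).1 hinj⟩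

theorem iso_of_isIrreducible {V : Type*} [AddCommGroup V] [Module ℂ V]
    (ρ : Corepresentation (A2 G) V) (hρ : ρ.IsIrreducible) :
    ρ.Iso (Corepresentation.trivial (A2 G)) ∨ ρ.Iso (d G) ∨
      ∃ x : Monoid.Coprod G G, x ≠ 1 ∧ ρ.Iso (v x) := by
  have := hρ.1
  obtain ⟨z, f, hf, h0⟩ := exists_isIntertwiner_v ρ
  by_cases hz : z = 1
  · subst hz
    obtain ⟨e, he⟩ := directSum_trivial_d_iso_v_one (G := G)
    have hf' := hf.comp he
    have hl := hf'.comp (isIntertwiner_inl _ _)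
    have hr := hf'.comp (isIntertwiner_inr _ _)
    by_cases hl0 : (f ∘ₗ e.toLinearMap) ∘ₗ LinearMap.inl ℂ ℂ ℂ = 0
    · by_cases hr0 : (f ∘ₗ e.toLinearMap) ∘ₗ LinearMap.inr ℂ ℂ ℂ = 0
      · have h : f ∘ₗ e.toLinearMap = 0 := LinearMap.prod_ext hl0 hr0
        refine absurd (LinearMap.ext fun c => ?_) h0
        simpa using LinearMap.congr_fun h (e.symm c)
      · exact .inr (.inl (hr.iso_of_ne_zero (isIrreducible_of_complex _) hρ hr0).symm)
    · exact .inl (hl.iso_of_ne_zero (isIrreducible_of_complex _) hρ hl0).symm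
  · exact .inr (.inr ⟨z, hz, (hf.iso_of_ne_zero (isIrreducible_v hz) hρ h0).symm⟩)

/-! ### The fusion rules -/

/-- The vectors `e j ⊗ e j` span a copy of `v (x y)`, and the vectors `e j ⊗ e (1 - j)` a copy of
`v (x τ(y))`. -/
theorem tensor_v_iso (x y : Monoid.Coprod G G) :
    ((v x).tensor (v y)).Iso ((v (x * y)).directSum (v (x * tau y))) := by
  have hc : ∀ j l : Fin 2, ((v x).tensor (v y)).coact (Pi.single j 1 ⊗ₜ[ℂ] Pi.single l 1) =
      ∑ i, ∑ k, (Pi.single i (1 : ℂ) ⊗ₜ[ℂ] Pi.single k (1 : ℂ)) ⊗ₜ[ℂ]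
        (vMatrix x i j * vMatrix y k l) := fun j l => by
    rw [tensor_coact_tmul, v, v, ofMatrix_coact_single, ofMatrix_coact_single]
    simp only [TensorProduct.sum_tmul, TensorProduct.tmul_sum, map_sum, mulCoeff_tmul]
    exact Finset.sum_comm
  have hτ : ∀ i j k l : Fin 2, k ≠ i → vMatrix x i j * vMatrix y k l =
      if j = 1 - l then vMatrix (x * tau y) i j else 0 := fun i j k l hki => by
    have h := vMatrix_tau (tau y) k l
    rw [tau_tau] at h
    have hk : 1 - k = i := by omega
    rw [h, hk, vMatrix_mul]
  let f₁ : (Fin 2 → ℂ) →ₗ[ℂ] (Fin 2 → ℂ) ⊗[ℂ] (Fin 2 → ℂ) :=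
    (Pi.basisFun ℂ (Fin 2)).constr ℂ fun j => Pi.single j 1 ⊗ₜ[ℂ] Pi.single j 1
  let f₂ : (Fin 2 → ℂ) →ₗ[ℂ] (Fin 2 → ℂ) ⊗[ℂ] (Fin 2 → ℂ) :=
    (Pi.basisFun ℂ (Fin 2)).constr ℂ fun j => Pi.single j 1 ⊗ₜ[ℂ] Pi.single (1 - j) 1
  have hf₁ : ∀ j, f₁ (Pi.single j 1) = Pi.single j 1 ⊗ₜ[ℂ] Pi.single j 1 := fun j => by
    rw [← Pi.basisFun_apply, Module.Basis.constr_basis, Pi.basisFun_apply]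
  have hf₂ : ∀ j, f₂ (Pi.single j 1) = Pi.single j 1 ⊗ₜ[ℂ] Pi.single (1 - j) 1 := fun j => by
    rw [← Pi.basisFun_apply, Module.Basis.constr_basis, Pi.basisFun_apply]
  have h := isIntertwiner_coprod
    (isIntertwiner_ofMatrix (hΔ := comul_vMatrix (x * y)) (hε := counit_vMatrix _)
      (σ := (v x).tensor (v y)) (f := f₁) fun j => by
        simp only [hf₁, hc]
        fin_cases j <;> simp [hτ, vMatrix_mul])
    (isIntertwiner_ofMatrix (hΔ := comul_vMatrix (x * tau y)) (hε := counit_vMatrix _)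
      (σ := (v x).tensor (v y)) (f := f₂) fun j => by
        simp only [hf₂, hc]
        fin_cases j <;> simp [hτ, vMatrix_mul])
  refine (IsIntertwiner.iso h ?_).symm
  have hsurj : Function.Surjective (f₁.coprod f₂) := by
    refine LinearMap.range_eq_top.1 (eq_top_iff.2 ?_)
    rw [← ((Pi.basisFun ℂ (Fin 2)).tensorProduct (Pi.basisFun ℂ (Fin 2))).span_eq,
      Submodule.span_le]
    rintro _ ⟨⟨i, k⟩, rfl⟩
    rw [Module.Basis.tensorProduct_apply, Pi.basisFun_apply, Pi.basisFun_apply]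
    by_cases hik : k = i
    · exact ⟨(Pi.single i 1, 0), by simp [hf₁, hik]⟩
    · have hk : 1 - i = k := by omega
      exact ⟨(0, Pi.single i 1), by simp [hf₂, hk]⟩
  exact ⟨(LinearMap.injective_iff_surjective_of_finrank_eq_finrank (by simp)).2 hsurj, hsurj⟩

theorem tensor_v_inv_iso (x : Monoid.Coprod G G) :
    ((v x).tensor (v x⁻¹)).Iso
      (((Corepresentation.trivial (A2 G)).directSum (d G)).directSum (v (x * (tau x)⁻¹))) := by
  have h := tensor_v_iso x x⁻¹
  rw [mul_inv_cancel, map_inv] at h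
  exact h.trans (directSum_trivial_d_iso_v_one.symm.directSum (.refl _))

theorem tensor_d_d_iso : ((d G).tensor (d G)).Iso (Corepresentation.trivial (A2 G)) := by
  refine Iso.symm (IsIntertwiner.iso (f := (TensorProduct.rid ℂ ℂ).symm.toLinearMap) ?_
    (LinearEquiv.bijective _))
  refine isIntertwiner_ofGroupLike ?_
  simp only [LinearEquiv.coe_coe, TensorProduct.rid_symm_apply, tensor_coact_tmul, d,
    ofGroupLike_coact, mulCoeff_tmul, d_mul_d]

/-- The diagonal matrix `(1, -1)`, which conjugates `vMatrix x` to
`vMatrix x` multiplied by `x₁₁ - x₁₂`. -/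
def signFlip : (Fin 2 → ℂ) ≃ₗ[ℂ] (Fin 2 → ℂ) :=
  LinearEquiv.piCongrRight fun i => if i = 0 then LinearEquiv.refl ℂ ℂ else LinearEquiv.neg ℂ

theorem signFlip_single (j : Fin 2) :
    signFlip (Pi.single j 1) = (if j = 0 then 1 else -1 : ℂ) • Pi.single j 1 := by
  ext i
  fin_cases i <;> fin_cases j <;> simp [signFlip]

theorem vMatrix_mul_d (x : Monoid.Coprod G G) (i j : Fin 2) :
    vMatrix x i j * (An.x G 0 0 - An.x G 0 1) =
      (if i = 0 then 1 else -1 : ℂ) • (if j = 0 then 1 else -1 : ℂ) • vMatrix x i j := by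
  rw [vMatrix_apply, mul_assoc, mul_d]
  fin_cases i <;> fin_cases j <;> simp

theorem d_mul_vMatrix (x : Monoid.Coprod G G) (i j : Fin 2) :
    (An.x G 0 0 - An.x G 0 1) * vMatrix x i j = vMatrix x i j * (An.x G 0 0 - An.x G 0 1) := by
  obtain ⟨e1, e2⟩ := x_eq G
  have hx : Commute (An.x G 0 0 - An.x G 0 1 : A2 G) (An.x G i j) := by
    fin_cases i <;> fin_cases j <;>
      simp [Commute, SemiconjBy, e1, e2, mul_sub, sub_mul, x_mul]
  rw [vMatrix_apply]
  exact (((commute_emb _ 0 0).sub_right (commute_emb _ 0 1)).symm.mul_right hx).eq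

theorem tensor_v_d_iso (x : Monoid.Coprod G G) : ((v x).tensor (d G)).Iso (v x) := by
  refine Iso.symm (IsIntertwiner.iso
    (f := (signFlip.trans (TensorProduct.rid ℂ (Fin 2 → ℂ)).symm).toLinearMap) ?_
    (LinearEquiv.bijective _))
  refine isIntertwiner_ofMatrix fun j => ?_
  simp only [LinearEquiv.coe_coe, LinearEquiv.trans_apply, signFlip_single, map_smul,
    TensorProduct.rid_symm_apply, tensor_coact_tmul]
  rw [v, ofMatrix_coact_single]
  simp only [d, ofGroupLike_coact, TensorProduct.sum_tmul, map_sum, mulCoeff_tmul, vMatrix_mul_d]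
  simp only [TensorProduct.tmul_smul, ← TensorProduct.smul_tmul', Finset.smul_sum, smul_smul]
  refine Finset.sum_congr rfl fun i _ => congrArg (· • _) ?_
  fin_cases i <;> fin_cases j <;> simp

theorem tensor_d_v_iso (x : Monoid.Coprod G G) : ((d G).tensor (v x)).Iso (v x) := by
  refine Iso.symm (IsIntertwiner.iso
    (f := (signFlip.trans (TensorProduct.lid ℂ (Fin 2 → ℂ)).symm).toLinearMap) ?_
    (LinearEquiv.bijective _))
  refine isIntertwiner_ofMatrix fun j => ?_
  simp only [LinearEquiv.coe_coe, LinearEquiv.trans_apply, signFlip_single, map_smul,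
    TensorProduct.lid_symm_apply, tensor_coact_tmul]
  rw [v, ofMatrix_coact_single]
  simp only [d, ofGroupLike_coact, TensorProduct.tmul_sum, map_sum, mulCoeff_tmul, d_mul_vMatrix,
    vMatrix_mul_d]
  simp only [TensorProduct.tmul_smul, ← TensorProduct.smul_tmul', Finset.smul_sum, smul_smul]
  refine Finset.sum_congr rfl fun i _ => congrArg (· • _) ?_
  fin_cases i <;> fin_cases j <;> simp

end A2

end

theorem proposition2p6 {G : Type*} [Group G] [Nontrivial G] :
    -- `d` is a non-trivial one-dimensional (hence irreducible) corepresentation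
    ((A2.d G).IsIrreducible ∧ ¬ (A2.d G).Iso (Corepresentation.trivial (A2 G))) ∧
    -- the two-dimensional corepresentations `v x`, and the isomorphisms among them
    (∀ x : Monoid.Coprod G G, x ≠ 1 → (A2.v x).IsIrreducible) ∧
    (∀ x y : Monoid.Coprod G G, x ≠ 1 → y ≠ 1 →
      ((A2.v x).Iso (A2.v y) ↔ x = y ∨ x = A2.tau y)) ∧
    -- every non-trivial irreducible corepresentation is in the list
    (∀ (V : Type*) [AddCommGroup V] [Module ℂ V] (ρ : Corepresentation (A2 G) V),
      ρ.IsIrreducible → ¬ ρ.Iso (Corepresentation.trivial (A2 G)) →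
        ρ.Iso (A2.d G) ∨ ∃ x : Monoid.Coprod G G, x ≠ 1 ∧ ρ.Iso (A2.v x)) ∧
    -- the fusion rules
    (∀ x y : Monoid.Coprod G G, x ≠ 1 → y ≠ 1 → x ≠ y⁻¹ → x ≠ (A2.tau y)⁻¹ →
      ((A2.v x).tensor (A2.v y)).Iso ((A2.v (x * y)).directSum (A2.v (x * A2.tau y)))) ∧
    (∀ x : Monoid.Coprod G G, x ≠ 1 →
      ((A2.v x).tensor (A2.v x⁻¹)).Iso
        (((Corepresentation.trivial (A2 G)).directSum (A2.d G)).directSum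
          (A2.v (x * (A2.tau x)⁻¹)))) ∧
    ((A2.d G).tensor (A2.d G)).Iso (Corepresentation.trivial (A2 G)) ∧
    (∀ x : Monoid.Coprod G G, x ≠ 1 →
      ((A2.v x).tensor (A2.d G)).Iso (A2.v x) ∧
      ((A2.d G).tensor (A2.v x)).Iso (A2.v x)) := by
  refine ⟨⟨Corepresentation.isIrreducible_of_complex _, A2.not_iso_d_trivial⟩,
    fun x hx => A2.isIrreducible_v hx, fun x y _ _ => A2.iso_v_iff,
    fun V _ _ ρ hρ h => (A2.iso_of_isIrreducible ρ hρ).resolve_left h,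
    fun x y _ _ _ _ => A2.tensor_v_iso x y, fun x _ => A2.tensor_v_inv_iso x,
    A2.tensor_d_d_iso, fun x _ => ⟨A2.tensor_v_d_iso x, A2.tensor_d_v_iso x⟩⟩
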